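/- **Setting.** Let $\mathcal A$ be a finite set of alternatives with unit costs and budget $B$, $1\le B<|\mathcal A|$; let $\mathcal L=\{0,1,\dots,\bar\ell\}$ with $\bar\ell\ge1$. Alternative $j$ has quality $L_j\in\mathcal L$, drawn independently over $j$ with $\Pr[L_j=\ell]=\mathbf P_j^\ell>0$. Given $\mathbf L=(L_j)_{j\in\mathcal A}$, each of $n$ agents receives, independently over agents and alternatives, binary signals, positive about $j$ with probability $\mathbf Q_j^{L_j}$, where $\mathbf Q_j^\ell\in(0,1)$. Each agent knows only his/her own signal vector and submits an approval ballot. The rule AV orders the alternatives by number of approvals (largest first), ties being resolved by a fixed priority order in which a given alternative, called $1$, comes last, and adds alternatives in this order as long as they fit in the budget. All agents have utility $v(W)=\sum_{j\in W}L_j$ from the winning set $W$. A (pure) strategy maps the signal vector of an agent to a ballot; informative voting is the profile in which everyone approves exactly the alternatives with a positive signal. A profile is a Bayes–Nash equilibrium (BNE) if no agent, given any signal vector he/she may have received, can increase his/her conditional expected utility by changing his/her own strategy. **Pivotal pairs.** For approval counts $x=(x_j)_{j\in\mathcal A}$ let $\mathcal P=(\mathcal A_>,\mathcal A_=,\mathcal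 A_<)$ be the partition of $\mathcal A\setminus\{1\}$ according to whether $x_j>x_1$, $x_j=x_1$ or $x_j<x_1$. The partition determines whether one more approval for $1$ changes the outcome of AV, in which case $1$ replaces a winner $j(\mathcal P)$. Let $\mathit{Piv}^+$ (resp. $\mathit{Piv}^-$) be the set of pairs $(\mathcal P,\mathbf L)$ such that the outcome changes and $L_1>L_{j(\mathcal P)}$ (resp. $L_1<L_{j(\mathcal P)}$). **Rates.** With $D(t\|p)=t\ln\frac tp+(1-t)\ln\frac{1-t}{1-p}$ (where $0\ln0=0$) and $p_j=\mathbf Q_j^{L_j}$, let $$G(\mathcal P,\mathbf L,\mathbf Q)=\min_{t\in[0,1]}\Big[D(t\|p_1)+\sum_{j\in\mathcal A_=}D(t\|p_j)+\sum_{j\in\mathcal A_>,\,p_j<t}D(t\|p_j)+\sum_{j\in\mathcal A_<,\,p_j>t}D(t\|p_j)\Big],$$ and let $G^{+}_{\min}(\mathbf Q)$ and $G^{-}_{\min}(\mathbf Q)$ be the minima of $G(\mathcal P,\mathbf L,\mathbf Q)$ over $(\mathcal P,\mathbf L)\in\mathit{Piv}^{+}$ and $\mathit{Piv}^{-}$,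 respectively. **Theorem 7.** The two minima exist (both sets are nonempty and finite). Keep everything but $n$ fixed. If informative voting is a BNE under AV for infinitely many $n$ (in particular, if it is one for all sufficiently large $n$), then $G^-_{\min}(\mathbf Q)=G^+_{\min}(\mathbf Q)$. Equivalently, if $G^-_{\min}(\mathbf Q)\neq G^+_{\min}(\mathbf Q)$, then informative voting is not a BNE for any sufficiently large $n$. -/

import Mathlib

open Filter Finset

noncomputable section

namespace EpistemicPB

/-! ### Environments -/

/-- The two utility functions of the model. -/
inductive UtilityKind
  | normal
  | costProportional

/-- An epistemic participatory-budgeting environment on a finite set `A` of alternatives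
(everything except the number of agents). Qualities range over `{0, …, maxQuality}`; the quality
of `j` equals `ℓ` with probability `prior j ℓ`, independently over `j`; `info j ℓ` is the
probability that an agent receives a positive signal about `j` when `j` has quality `ℓ`. -/
structure Environment (A : Type*) [Fintype A] where
  cost : A → ℝ
  cost_pos : ∀ j, 0 < cost j
  budget : ℝ
  cost_le_budget : ∀ j, cost j ≤ budget
  maxQuality : ℕ
  prior : A → Fin (maxQuality + 1) → ℝ
  prior_nonneg : ∀ j ℓ, 0 ≤ prior j ℓ
  prior_sum : ∀ j, ∑ ℓ, prior j ℓ = 1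
  info : A → Fin (maxQuality + 1) → ℝ
  info_pos : ∀ j ℓ, 0 < info j ℓ
  info_lt_one : ∀ j ℓ, info j ℓ < 1
  utilityKind : UtilityKind

/-- A vector of binary signals (`true` is the positive signal). -/
abbrev Signal (A : Type*) := A → Bool

/-- An approval ballot (`true` means that the alternative is approved). -/
abbrev Ballot (A : Type*) := A → Bool

/-- A strategy maps the signals of an agent to a ballot. -/
abbrev Strategy (A : Type*) := Signal A → Ballot A

section
variable {A : Type*} [Fintype A]

/-- A quality vector. -/
abbrev Environment.Quality (E : Environment A) := A → Fin (E.maxQuality + 1)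

/-- The common utility of a winning set `W` when the quality vector is `L`. -/
def Environment.utility (E : Environment A) (L : E.Quality) (W : Finset A) : ℝ :=
  match E.utilityKind with
  | .normal => ∑ j ∈ W, ((L j : ℕ) : ℝ)
  | .costProportional => ∑ j ∈ W, E.cost j * ((L j : ℕ) : ℝ)

/-! ### Approval voting -/

/-- The alternatives ordered by number of approvals, from largest to smallest. Ties are resolved
by the fixed priority order on `A`: of two tied alternatives, the larger one comes first. -/
def ranking [LinearOrder A] (x : A → ℕ) : List A :=
  (((univ : Finset A).image fun j => toLex (x j, j)).sort (fun p q => q ≤ p)).map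
    fun p => (ofLex p).2

/-- Greedy approval voting when alternative `j` has `x j` approvals: go through the alternatives
in the order of `ranking x`, skipping those that do not fit in the remaining budget. -/
def Environment.avOfCounts [LinearOrder A] (E : Environment A) (x : A → ℕ) : Finset A :=
  (ranking x).foldl (fun W j => if ∑ k ∈ W, E.cost k + E.cost j ≤ E.budget then insert j W else W) ∅

/-- The number of agents who approve each alternative. -/
def approvals {n : ℕ} (ballots : Fin n → Ballot A) (j : A) : ℕ :=
  #{i : Fin n | ballots i j = true}

/-- The voting rule AV, on ballot profiles. -/
def Environment.av [LinearOrder A] (E : Environment A) {n : ℕ} (ballots : Fin n → Ballot A) :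
    Finset A :=
  E.avOfCounts (approvals ballots)

/-! ### Beliefs and equilibria -/

/-- The probability of the signal vector `s` of one agent when the quality vector is `L`. -/
def Environment.signalProb (E : Environment A) (L : E.Quality) (s : Signal A) : ℝ :=
  ∏ j, if s j = true then E.info j (L j) else 1 - E.info j (L j)

/-- The joint probability of the quality vector `L` and the signal profile `S` of `n` agents. -/
def Environment.jointProb (E : Environment A) {n : ℕ} (L : E.Quality) (S : Fin n → Signal A) : ℝ :=
  (∏ j, E.prior j (L j)) * ∏ i, E.signalProb L (S i)

/-- The expected utility of agent `i` under AV and the strategy profile `σ`, conditionally on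
agent `i` having received the signal vector `s`. -/
def Environment.expectedUtility [LinearOrder A] (E : Environment A) {n : ℕ}
    (σ : Fin n → Strategy A) (i : Fin n) (s : Signal A) : ℝ :=
  (∑ L : E.Quality, ∑ S : Fin n → Signal A with S i = s,
      E.jointProb L S * E.utility L (E.av fun k => σ k (S k))) /
    ∑ L : E.Quality, ∑ S : Fin n → Signal A with S i = s, E.jointProb L S

/-- Bayes--Nash equilibrium under AV. -/
def Environment.IsBNE [LinearOrder A] (E : Environment A) {n : ℕ} (σ : Fin n → Strategy A) :
    Prop :=
  ∀ (i : Fin n) (s : Signal A) (σ' : Strategy A),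
    E.expectedUtility (Function.update σ i σ') i s ≤ E.expectedUtility σ i s

/-- The informative profile of `n` agents: everybody reports their signals. -/
def informative (A : Type*) (n : ℕ) : Fin n → Strategy A := fun _ s => s

/-! ### Pivotal events -/

/-- A partition `(A_>, A_=, A_<)` of the alternatives other than `a`, coded by the function that
is `gt`, `eq`, `lt` on `A_>`, `A_=`, `A_<`. -/
abbrev Pattern (a : A) := {j : A // j ≠ a} → Ordering

/-- The numbers of approvals `x` follow the partition `P`: the alternatives in `A_>`, `A_=`, `A_<`
have more, equally many, fewer approvals than `a`. -/
def Follows {a : A} (x : A → ℕ) (P : Pattern a) : Prop :=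
  ∀ j : {j : A // j ≠ a}, compare (x j) (x a) = P j

/-- One more approval for `a` replaces the winner `j` by `a` whenever the approvals follow `P`. -/
def Environment.Replaces [LinearOrder A] (E : Environment A) {a : A} (P : Pattern a) (j : A) :
    Prop :=
  ∀ x : A → ℕ, Follows x P →
    j ∈ E.avOfCounts x ∧ a ∉ E.avOfCounts x ∧
      E.avOfCounts (Function.update x a (x a + 1)) = insert a ((E.avOfCounts x).erase j)

/-- The pivotal pairs in which one more approval for `a` increases the utility. -/
def Environment.PivPlus [LinearOrder A] (E : Environment A) (a : A) :
    Set (Pattern a × E.Quality) :=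
  {PL | ∃ j, E.Replaces PL.1 j ∧ PL.2 j < PL.2 a}

/-- The pivotal pairs in which one more approval for `a` decreases the utility. -/
def Environment.PivMinus [LinearOrder A] (E : Environment A) (a : A) :
    Set (Pattern a × E.Quality) :=
  {PL | ∃ j, E.Replaces PL.1 j ∧ PL.2 a < PL.2 j}

/-! ### Large-deviation rates -/

/-- The relative entropy of the Bernoulli distribution with mean `t` with respect to that with
mean `p` (with `0 ln 0 = 0`). -/
def bernoulliKL (t p : ℝ) : ℝ :=
  t * Real.log (t / p) + (1 - t) * Real.log ((1 - t) / (1 - p))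

/-- The cost at threshold `t` of the constraint that an alternative with approval probability `p`
is above (`gt`), at (`eq`) or below (`lt`) the threshold. -/
def constraintCost (o : Ordering) (t p : ℝ) : ℝ :=
  match o with
  | .eq => bernoulliKL t p
  | .gt => if p < t then bernoulliKL t p else 0
  | .lt => if t < p then bernoulliKL t p else 0

/-- The rate function `t ↦ G(t)` of the pair `(P, L)`. -/
def Environment.rateAt (E : Environment A) {a : A} [DecidableEq A] (P : Pattern a)
    (L : E.Quality) (t : ℝ) : ℝ :=
  bernoulliKL t (E.info a (L a)) +
    ∑ j : {j : A // j ≠ a}, constraintCost (P j) t (E.info j (L j))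

/-- The exponential decay rate `G(P, L, Q)`: the minimum of `G(t)` over `t ∈ [0, 1]`. -/
def Environment.rate (E : Environment A) {a : A} [DecidableEq A] (P : Pattern a) (L : E.Quality) :
    ℝ :=
  sInf ((fun t => E.rateAt P L t) '' Set.Icc (0 : ℝ) 1)

/-- The set of the rates of the utility-increasing pivotal pairs. -/
def Environment.ratesPlus [LinearOrder A] (E : Environment A) (a : A) : Set ℝ :=
  (fun PL : Pattern a × E.Quality => E.rate PL.1 PL.2) '' E.PivPlus a

/-- The set of the rates of the utility-decreasing pivotal pairs. -/
def Environment.ratesMinus [LinearOrder A] (E : Environment A) (a : A) : Set ℝ :=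
  (fun PL : Pattern a × E.Quality => E.rate PL.1 PL.2) '' E.PivMinus a

/-- `G⁺_min(Q)`. -/
def Environment.GPlusMin [LinearOrder A] (E : Environment A) (a : A) : ℝ := sInf (E.ratesPlus a)

/-- `G⁻_min(Q)`. -/
def Environment.GMinusMin [LinearOrder A] (E : Environment A) (a : A) : ℝ := sInf (E.ratesMinus a)

end

end EpistemicPB

end

noncomputable section
namespace EpistemicPB

/-! ### Approval voting with unit costs -/

/-! The proof compares two ballots that differ only in the approval of `a`: the empty one and
`approveOnly a`. An agent with no positive signal must not gain by adding `a`; an agent whose only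
positive signal is about `a` must not gain by dropping it. Neither ballot approves anything else, so
the effect depends only on the counts `x` of the other agents. By `avOfCounts_bump_eq_or_replaces`,
the pattern of `x` determines whether `a` replaces a winner, and which one. The gain is then at
least 1 on `PivPlus`, at most -1 on `PivMinus`, zero elsewhere, and at most `maxQuality` in absolute
value (`gain_bounds`).

The posterior weights of the quality vectors lie between positive constants that do not depend on
the number of agents. The two equilibrium inequalities therefore bound the masses of `PivPlus` and
`PivMinus` by constant multiples of each other (`exists_mass_le`).

Given the qualities, the counts are independent binomials. The method of types bounds each binomial
probability by `exp (-n * D)` up to a factor `n + 1`, and there are only polynomially many count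
vectors. So the mass of a set of pivotal pairs decays at the smallest rate in the set (`mass_le`,
`eventually_le_mass`). Masses comparable for infinitely many `n` force equal smallest rates
(`le_of_frequently_mass_le`). -/

/-- With unit costs the capacity test depends only on how many alternatives were chosen: once it
fails, it fails for the rest of the list, so nothing is skipped and then followed by an addition. -/
lemma foldl_greedy {A : Type*} [DecidableEq A] (m : ℕ) (l : List A) (W : Finset A) (hl : l.Nodup) (hW : ∀ j ∈ l, j ∉ W) :
    l.foldl (fun W j => if #W + 1 ≤ m then insert j W else W) W =
      W ∪ (l.take (m - #W)).toFinset := by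
  induction l generalizing W with
  | nil => simp
  | cons i l ih =>
    rw [List.nodup_cons] at hl
    rw [List.foldl_cons]
    have hi : i ∉ W := hW i (by simp)
    split_ifs with h
    · rw [ih _ hl.2, card_insert_of_notMem hi]
      · obtain ⟨d, hd⟩ : ∃ d, m - #W = d + 1 := ⟨m - #W - 1, by omega⟩
        have hd' : m - (#W + 1) = d := by omega
        rw [hd, hd', List.take_succ_cons]
        ext k
        simp only [mem_union, mem_insert, List.mem_toFinset, List.mem_cons]
        tauto
      · intro j hj
        rw [mem_insert, not_or]
        exact ⟨fun hji => hl.1 (hji ▸ hj), hW j (by simp [hj])⟩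
    · rw [ih _ hl.2 fun j hj => hW j (by simp [hj])]
      have : m - #W = 0 := by omega
      simp [this]

/-- The pattern that the numbers of approvals `x` follow. -/
def patternOf {A : Type*} (a : A) (x : A → ℕ) : Pattern a := fun j => compare (x j) (x a)

lemma follows_iff {A : Type*} {a : A} {x : A → ℕ} {P : Pattern a} : Follows x P ↔ patternOf a x = P := by
  simp [Follows, patternOf, funext_iff]

/-- The numbers of approvals after one more approval for `a`. -/
abbrev bump {A : Type*} [DecidableEq A] (a : A) (x : A → ℕ) : A → ℕ := Function.update x a (x a + 1)

lemma compare_lt_congr {p q r s : ℕ} (h : compare p q = compare r s) : (p < q ↔ r < s) := by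
  rw [← compare_lt_iff_lt, h, compare_lt_iff_lt]

lemma compare_gt_congr {p q r s : ℕ} (h : compare p q = compare r s) : (q < p ↔ s < r) := by
  rw [← compare_gt_iff_gt, h, compare_gt_iff_gt]

/-- Plain inequalities, including the trivial case `j = a`, let `omega` handle equality of patterns.
-/
lemma patternOf_eq_iff {A : Type*} [DecidableEq A] {a : A} {x y : A → ℕ} :
    patternOf a x = patternOf a y ↔ ∀ j, (x j < x a ↔ y j < y a) ∧ (x a < x j ↔ y a < y j) := by
  constructor
  · intro h j
    by_cases hj : j = a
    · subst hj
      simp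
    · have := congrFun h ⟨j, hj⟩
      exact ⟨compare_lt_congr this, compare_gt_congr this⟩
  · intro h
    funext ⟨j, hj⟩
    have h1 := h j
    unfold patternOf
    rcases lt_trichotomy (x j) (x a) with h2 | h2 | h2
    · rw [compare_lt_iff_lt.mpr h2, compare_lt_iff_lt.mpr (h1.1.mp h2)]
    · have : y j = y a := by omega
      simp [h2, this]
    · rw [compare_gt_iff_gt.mpr h2, compare_gt_iff_gt.mpr (h1.2.mp h2)]

section Voting
variable {A : Type*} [Fintype A] [LinearOrder A]

/-- The alternatives that precede `j` in the ranking. -/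
def above (x : A → ℕ) (j : A) : Finset A :=
  {k | toLex (x j, j) < toLex (x k, k)}

lemma mem_above {x : A → ℕ} {j k : A} : k ∈ above x j ↔ x j < x k ∨ x j = x k ∧ j < k := by
  simp [above, Prod.Lex.toLex_lt_toLex]

lemma mem_ranking (x : A → ℕ) (j : A) : j ∈ ranking x := by
  simp [ranking]

lemma ranking_pairwise (x : A → ℕ) : (ranking x).Pairwise fun i j => i ∈ above x j := by
  unfold ranking
  rw [List.pairwise_map]
  have h1 := Finset.pairwise_sort ((univ : Finset A).image fun j => toLex (x j, j))
    fun p q => q ≤ p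
  have h2 := Finset.sort_nodup ((univ : Finset A).image fun j => toLex (x j, j))
    fun p q => q ≤ p
  refine List.Pairwise.imp_of_mem ?_ (h1.and h2)
  rintro p q hp hq ⟨hle, hne⟩
  have hpq := lt_of_le_of_ne hle hne.symm
  simp only [Finset.mem_sort, Finset.mem_image, Finset.mem_univ, true_and] at hp hq
  obtain ⟨i, rfl⟩ := hp
  obtain ⟨j, rfl⟩ := hq
  exact mem_filter.mpr ⟨mem_univ _, hpq⟩

lemma not_mem_above_self (x : A → ℕ) (j : A) : j ∉ above x j := by
  simp [mem_above]

lemma ranking_nodup (x : A → ℕ) : (ranking x).Nodup :=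
  (ranking_pairwise x).imp (S := (· ≠ ·)) fun h hij => not_mem_above_self x _ (hij ▸ h)

lemma length_ranking (x : A → ℕ) : (ranking x).length = Fintype.card A := by
  rw [← List.toFinset_card_of_nodup (ranking_nodup x)]
  have : (ranking x).toFinset = univ := by
    ext j
    simp [mem_ranking]
  rw [this, card_univ]

variable (E : Environment A)

lemma Environment.avOfCounts_eq_take (hunit : ∀ j, E.cost j = 1) (x : A → ℕ) :
    E.avOfCounts x = ((ranking x).take ⌊E.budget⌋₊).toFinset := by
  have h := foldl_greedy ⌊E.budget⌋₊ (ranking x) ∅ (ranking_nodup x) (by simp)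
  rw [card_empty, Nat.sub_zero, empty_union] at h
  rw [← h]
  unfold Environment.avOfCounts
  congr 1
  funext W j
  have : (∑ k ∈ W, E.cost k + E.cost j ≤ E.budget) ↔ #W + 1 ≤ ⌊E.budget⌋₊ := by
    rw [Nat.le_floor_iff' (by omega)]
    simp [hunit]
  simp only [this]

variable (hunit : ∀ j, E.cost j = 1) (hbudget : E.budget < Fintype.card A)

section
include hunit hbudget

lemma Environment.card_avOfCounts (x : A → ℕ) : #(E.avOfCounts x) = ⌊E.budget⌋₊ := by
  rw [E.avOfCounts_eq_take hunit,
    List.toFinset_card_of_nodup ((ranking_nodup x).sublist (List.take_sublist _ _)),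
    List.length_take, length_ranking]
  have := Nat.floor_le_of_le hbudget.le
  omega

/-- The winners form an initial segment of the ranking with exactly `⌊E.budget⌋₊` elements. A winner
has only winners above it; a loser has all the winners above it. -/
lemma Environment.mem_avOfCounts_iff (x : A → ℕ) (j : A) :
    j ∈ E.avOfCounts x ↔ #(above x j) < ⌊E.budget⌋₊ := by
  have hcard := E.card_avOfCounts hunit hbudget x
  have key : ∀ i ∈ E.avOfCounts x, ∀ k ∉ E.avOfCounts x, i ∈ above x k := by
    intro i hi k hk
    rw [E.avOfCounts_eq_take hunit, List.mem_toFinset] at hi hk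
    have hp := ranking_pairwise x
    have hmem := mem_ranking x k
    rw [← List.take_append_drop ⌊E.budget⌋₊ (ranking x)] at hp hmem
    rw [List.pairwise_append] at hp
    exact hp.2.2 i hi k ((List.mem_append.mp hmem).resolve_left hk)
  constructor
  · intro hj
    have hsub : insert j (above x j) ⊆ E.avOfCounts x := by
      intro k hk
      rcases mem_insert.mp hk with rfl | hk
      · exact hj
      · by_contra hkW
        have := key j hj k hkW
        rw [mem_above] at hk this
        rcases hk with hk | hk <;> rcases this with h | h
        · omega
        · omega
        · omega
        · exact lt_asymm hk.2 h.2
    have := card_le_card hsub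
    rw [card_insert_of_notMem (not_mem_above_self x j), hcard] at this
    omega
  · intro hlt
    by_contra hj
    have := card_le_card fun i hi => key i hi j hj
    omega

end

/-- A pattern records comparisons with `a` only, but for `j` tied with `a` these are comparisons
with `j`. -/
lemma above_congr {a : A} {x y : A → ℕ} (h : patternOf a x = patternOf a y) {j : A} (hj : x j = x a) :
    above x j = above y j := by
  rw [patternOf_eq_iff] at h
  ext k
  rw [mem_above, mem_above]
  have h1 := h j
  have h2 := h k
  have e1 : x j < x k ↔ y j < y k := by omega
  have e2 : x j = x k ↔ y j = y k := by omega
  rw [e1, e2]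

/-! ### The effect of one more approval for the alternative of lowest priority -/

section
variable {a : A} (ha : ∀ j, a ≤ j)
include ha

lemma above_bump_subset {x : A → ℕ} {j : A} (hj : j ≠ a) : above x j ⊆ above (bump a x) j := by
  intro k
  rw [mem_above, mem_above]
  by_cases hk : k = a
  · subst hk
    have := ha j
    simp [hj]
    rintro (h | h)
    · left; omega
    · left; omega
  · simp [hj, hk]

/-- Lowest priority of `a` is essential: after the extra approval, an alternative with `x a + 1`
approvals still precedes `a`. Thus `k ≠ a` is above `a` exactly when `x a < x k`, which the pattern
records. -/
lemma above_bump_congr {x y : A → ℕ} (h : patternOf a x = patternOf a y) {j : A}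
    (hj : x j = x a) : above (bump a x) j = above (bump a y) j := by
  rw [patternOf_eq_iff] at h
  ext k
  rw [mem_above, mem_above]
  have h1 := h j
  have h2 := h k
  by_cases hja : j = a <;> by_cases hka : k = a
  · simp [hja, hka]
  · subst hja
    have hlt := lt_of_le_of_ne (ha k) (Ne.symm hka)
    simp [hka, hlt]
    omega
  · subst hka
    have hlt := lt_of_le_of_ne (ha j) (Ne.symm hja)
    simp [hja, hlt.not_gt]
    omega
  · simp only [bump, Function.update_of_ne hja, Function.update_of_ne hka]
    have e1 : x j < x k ↔ y j < y k := by omega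
    have e2 : x j = x k ↔ y j = y k := by omega
    rw [e1, e2]

include hunit hbudget

lemma Environment.mem_avOfCounts_of_mem_bump {x : A → ℕ} {j : A} (hj : j ≠ a)
    (h : j ∈ E.avOfCounts (bump a x)) : j ∈ E.avOfCounts x := by
  rw [E.mem_avOfCounts_iff hunit hbudget] at h ⊢
  exact (card_le_card (above_bump_subset ha hj)).trans_lt h

lemma Environment.avOfCounts_bump_eq {x : A → ℕ} {j : A} (h1 : a ∉ E.avOfCounts x)
    (h3 : j ∈ E.avOfCounts x)
    (h4 : j ∉ E.avOfCounts (bump a x)) :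
    E.avOfCounts (bump a x) = insert a ((E.avOfCounts x).erase j) := by
  apply eq_of_subset_of_card_le
  · intro k hk
    by_cases hka : k = a
    · simp [hka]
    · refine mem_insert_of_mem (mem_erase.mpr ⟨?_, ?_⟩)
      · rintro rfl
        exact h4 hk
      · exact E.mem_avOfCounts_of_mem_bump hunit hbudget ha hka hk
  · rw [card_insert_of_notMem (by simp [h1]), card_erase_of_mem h3,
      E.card_avOfCounts hunit hbudget, E.card_avOfCounts hunit hbudget]
    have : 0 < ⌊E.budget⌋₊ := by
      rw [← E.card_avOfCounts hunit hbudget x]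
      exact card_pos.mpr ⟨j, h3⟩
    omega

/-- One more approval for `a` has no effect, or its effect is determined by the pattern. -/
lemma Environment.avOfCounts_bump_eq_or_replaces (x : A → ℕ) :
    E.avOfCounts (bump a x) = E.avOfCounts x ∨ ∃ j, E.Replaces (patternOf a x) j := by
  by_cases hsub : E.avOfCounts (bump a x) ⊆ E.avOfCounts x
  · left
    apply eq_of_subset_of_card_le hsub
    rw [E.card_avOfCounts hunit hbudget, E.card_avOfCounts hunit hbudget]
  right
  -- No other alternative can enter the winning set, since the extra approval moves only `a` up.
  have ha1 : a ∉ E.avOfCounts x ∧ a ∈ E.avOfCounts (bump a x) := by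
    obtain ⟨k, hk, hk'⟩ := not_subset.mp hsub
    by_cases hka : k = a
    · subst hka
      exact ⟨hk', hk⟩
    · exact absurd (E.mem_avOfCounts_of_mem_bump hunit hbudget ha hka hk) hk'
  have hns : ¬ E.avOfCounts x ⊆ E.avOfCounts (bump a x) := by
    intro h
    have := eq_of_subset_of_card_le h (by
      rw [E.card_avOfCounts hunit hbudget, E.card_avOfCounts hunit hbudget])
    rw [this] at ha1
    exact ha1.1 ha1.2
  obtain ⟨j, hj, hj'⟩ := not_subset.mp hns
  have hja : j ≠ a := by
    rintro rfl
    exact ha1.1 hj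
  -- To displace `j`, `a` has to overtake it. As `a` loses ties before and after the extra approval,
  -- this needs `x a ≤ x j < x a + 1`.
  have hxj : x j = x a := by
    by_contra hne
    have : above (bump a x) j ⊆ above x j := by
      intro k
      rw [mem_above, mem_above]
      by_cases hka : k = a
      · subst hka
        have hlt := lt_of_le_of_ne (ha j) (Ne.symm hja)
        have h5 : x j < x k := by
          by_contra hge
          have : above (bump k x) j ⊆ above x j := by
            intro i
            rw [mem_above, mem_above]
            by_cases hik : i = k
            · subst hik
              simp [hja, hlt.not_gt]
              omega
            · simp [hja, hik]
          rw [E.mem_avOfCounts_iff hunit hbudget] at hj hj'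
          exact hj' ((card_le_card this).trans_lt hj)
        intro _
        exact Or.inl h5
      · simp [hja, hka]
    rw [E.mem_avOfCounts_iff hunit hbudget] at hj hj'
    exact hj' ((card_le_card this).trans_lt hj)
  refine ⟨j, fun y hy => ?_⟩
  rw [follows_iff] at hy
  have hy := hy.symm
  -- Everything needed for `y` concerns the positions of `a` and `j`, both tied with `a` under `x`,
  -- so it transfers along the pattern.
  have e1 : a ∉ E.avOfCounts y := by
    rw [E.mem_avOfCounts_iff hunit hbudget, ← above_congr hy rfl,
      ← E.mem_avOfCounts_iff hunit hbudget]
    exact ha1.1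
  have e3 : j ∈ E.avOfCounts y := by
    rw [E.mem_avOfCounts_iff hunit hbudget, ← above_congr hy hxj,
      ← E.mem_avOfCounts_iff hunit hbudget]
    exact hj
  have e4 : j ∉ E.avOfCounts (bump a y) := by
    rw [E.mem_avOfCounts_iff hunit hbudget, ← above_bump_congr ha hy hxj,
      ← E.mem_avOfCounts_iff hunit hbudget]
    exact hj'
  exact ⟨e3, e1, E.avOfCounts_bump_eq hunit hbudget ha e1 e3 e4⟩

/-- With all counts zero, `a` is ranked last and loses because the budget is below the number of
alternatives. One approval puts it first, and it wins because the budget is at least 1. -/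
lemma Environment.exists_replaces : ∃ (P : Pattern a) (j : A), j ≠ a ∧ E.Replaces P j := by
  have hK : 0 < ⌊E.budget⌋₊ := by
    rw [Nat.floor_pos, ← hunit a]
    exact E.cost_le_budget a
  have hK' : ⌊E.budget⌋₊ < Fintype.card A :=
    (Nat.floor_lt' (Fintype.card_pos_iff.mpr ⟨a⟩).ne').mpr hbudget
  set x : A → ℕ := fun _ => 0
  have h1 : a ∉ E.avOfCounts x := by
    have : above x a = univ.erase a := by
      ext k
      rw [mem_above]
      simp only [x, lt_self_iff_false, true_and, false_or, mem_erase, mem_univ, and_true]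
      exact ⟨fun h => h.ne', fun h => lt_of_le_of_ne (ha k) (Ne.symm h)⟩
    rw [E.mem_avOfCounts_iff hunit hbudget, this, card_erase_of_mem (mem_univ a), card_univ]
    omega
  have h2 : a ∈ E.avOfCounts (bump a x) := by
    have : above (bump a x) a = ∅ := by
      ext k
      rw [mem_above]
      by_cases hk : k = a
      · simp [hk]
      · simp [hk, x]
    rw [E.mem_avOfCounts_iff hunit hbudget, this, card_empty]
    exact hK
  rcases E.avOfCounts_bump_eq_or_replaces hunit hbudget ha x with h | ⟨j, hj⟩
  · rw [h] at h2
    exact absurd h2 h1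
  · refine ⟨_, j, ?_, hj⟩
    rintro rfl
    have := hj x (follows_iff.mpr rfl)
    exact this.2.1 this.1

end
end Voting
/-! ### Relative entropy of Bernoulli distributions -/

section Entropy

/-- Splitting off a part affine in `t` reduces continuity and convexity to those of `t * log t`; the
convention `log 0 = 0` covers the endpoints. -/
lemma bernoulliKL_eq {p : ℝ} (h0 : 0 < p) (h1 : p < 1) (t : ℝ) :
    bernoulliKL t p =
      t * Real.log t + (1 - t) * Real.log (1 - t) -
        (t * Real.log p + (1 - t) * Real.log (1 - p)) := by
  have key : ∀ s q : ℝ, 0 < q → s * Real.log (s / q) = s * Real.log s - s * Real.log q := by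
    intro s q hq
    rcases eq_or_ne s 0 with rfl | hs
    · simp
    · rw [Real.log_div hs hq.ne']
      ring
  rw [bernoulliKL, key t p h0, key (1 - t) (1 - p) (by linarith)]
  ring

lemma continuous_bernoulliKL {p : ℝ} (h0 : 0 < p) (h1 : p < 1) :
    Continuous fun t => bernoulliKL t p := by
  simp only [bernoulliKL_eq h0 h1]
  have h := Real.continuous_mul_log
  have h' : Continuous fun t : ℝ => (1 - t) * Real.log (1 - t) :=
    h.comp (continuous_const.sub continuous_id)
  fun_prop

lemma bernoulliKL_self {p : ℝ} (h0 : 0 < p) (h1 : p < 1) : bernoulliKL p p = 0 := by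
  rw [bernoulliKL_eq h0 h1]
  ring

lemma bernoulliKL_nonneg {p t : ℝ} (h0 : 0 < p) (h1 : p < 1) (ht : t ∈ Set.Icc (0 : ℝ) 1) :
    0 ≤ bernoulliKL t p := by
  -- Adding this bound for `(t, p)` and `(1 - t, 1 - p)`, the linear terms cancel.
  have key : ∀ s q : ℝ, 0 < q → 0 ≤ s → s - q ≤ s * Real.log (s / q) := by
    intro s q hq hs
    rcases hs.eq_or_lt with rfl | hs
    · simp [hq.le]
    · have := Real.one_sub_inv_le_log_of_pos (div_pos hs hq)
      have := mul_le_mul_of_nonneg_left this hs.le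
      rw [inv_div, mul_sub, mul_div_cancel₀ _ hs.ne', mul_one] at this
      exact this
  have e1 := key t p h0 ht.1
  have e2 := key (1 - t) (1 - p) (by linarith) (by linarith [ht.2])
  rw [bernoulliKL]
  linarith

lemma convexOn_bernoulliKL {p : ℝ} (h0 : 0 < p) (h1 : p < 1) :
    ConvexOn ℝ (Set.Icc (0 : ℝ) 1) fun t => bernoulliKL t p := by
  have hf : ConvexOn ℝ (Set.Icc (0 : ℝ) 1) fun t => t * Real.log t :=
    Real.convexOn_mul_log.subset (fun t ht => ht.1) (convex_Icc 0 1)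
  refine ⟨convex_Icc 0 1, fun s hs t ht u v hu hv huv => ?_⟩
  have e1 := hf.2 hs ht hu hv huv
  have e2 := hf.2 (x := 1 - s) ⟨by linarith [hs.2], by linarith [hs.1]⟩
    (y := 1 - t) ⟨by linarith [ht.2], by linarith [ht.1]⟩ hu hv huv
  simp only [smul_eq_mul, bernoulliKL_eq h0 h1] at e1 e2 ⊢
  have : u * (1 - s) + v * (1 - t) = 1 - (u * s + v * t) := by linear_combination huv
  rw [this] at e2
  have hv' : v = 1 - u := by linarith
  subst hv'
  linarith

lemma bernoulliKL_le_of_le_of_le {p t u : ℝ} (h0 : 0 < p) (h1 : p < 1) (hpt : p ≤ t)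
    (htu : t ≤ u) (hu : u ≤ 1) : bernoulliKL t p ≤ bernoulliKL u p := by
  have := (convexOn_bernoulliKL h0 h1).le_max_of_mem_Icc (x := p) (y := u) (z := t)
    ⟨h0.le, h1.le⟩ ⟨by linarith, hu⟩ ⟨hpt, htu⟩
  rwa [bernoulliKL_self h0 h1, max_eq_right (bernoulliKL_nonneg h0 h1 ⟨by linarith, hu⟩)] at this

lemma bernoulliKL_le_of_ge_of_ge {p t u : ℝ} (h0 : 0 < p) (h1 : p < 1) (hpt : t ≤ p)
    (htu : u ≤ t) (hu : 0 ≤ u) : bernoulliKL t p ≤ bernoulliKL u p := by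
  have := (convexOn_bernoulliKL h0 h1).le_max_of_mem_Icc (x := u) (y := p) (z := t)
    ⟨hu, by linarith⟩ ⟨h0.le, h1.le⟩ ⟨htu, hpt⟩
  rwa [bernoulliKL_self h0 h1, max_eq_left (bernoulliKL_nonneg h0 h1 ⟨hu, by linarith⟩)] at this

/-- The cheapest frequency that satisfies a constraint at threshold `t`. -/
def cheapest (o : Ordering) (t p : ℝ) : ℝ :=
  match o with
  | .eq => t
  | .gt => max t p
  | .lt => min t p

/-- This removes the case distinction: the cost is a continuous function of a continuous function of
`t`. -/
lemma constraintCost_eq {p : ℝ} (h0 : 0 < p) (h1 : p < 1) (o : Ordering) (t : ℝ) :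
    constraintCost o t p = bernoulliKL (cheapest o t p) p := by
  cases o
  · simp only [constraintCost, cheapest]
    split_ifs with h
    · rw [min_eq_left h.le]
    · rw [min_eq_right (not_lt.mp h), bernoulliKL_self h0 h1]
  · rfl
  · simp only [constraintCost, cheapest]
    split_ifs with h
    · rw [max_eq_left h.le]
    · rw [max_eq_right (not_lt.mp h), bernoulliKL_self h0 h1]

lemma continuous_cheapest (o : Ordering) (p : ℝ) : Continuous fun t => cheapest o t p := by
  cases o <;> simp only [cheapest] <;> fun_prop

lemma cheapest_mem_Ioo {p t : ℝ} (h0 : 0 < p) (h1 : p < 1) (o : Ordering)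
    (ht : t ∈ Set.Ioo (0 : ℝ) 1) : cheapest o t p ∈ Set.Ioo (0 : ℝ) 1 := by
  cases o <;> simp [cheapest, ht.1, ht.2, h0, h1]

lemma constraintCost_nonneg {p t : ℝ} (h0 : 0 < p) (h1 : p < 1) (o : Ordering)
    (ht : t ∈ Set.Icc (0 : ℝ) 1) : 0 ≤ constraintCost o t p := by
  have h := bernoulliKL_nonneg h0 h1 ht
  cases o <;> simp only [constraintCost] <;> (try split_ifs) <;> first | exact h | exact le_rfl

/-- When the constraint binds at `m / n`, the frequency `k / n` lies beyond `m / n` as seen from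
`p`, and the entropy grows away from `p`. Otherwise the cost is zero. -/
lemma constraintCost_compare_le {p : ℝ} (h0 : 0 < p) (h1 : p < 1) {n k m : ℕ} (hn : 0 < n)
    (hk : k ≤ n) (hm : m ≤ n) :
    constraintCost (compare k m) ((m : ℝ) / n) p ≤ bernoulliKL ((k : ℝ) / n) p := by
  have hn' : (0 : ℝ) < n := by exact_mod_cast hn
  have mem : ∀ i : ℕ, i ≤ n → (i : ℝ) / n ∈ Set.Icc (0 : ℝ) 1 := fun i hi =>
    ⟨by positivity, (div_le_one hn').mpr (by exact_mod_cast hi)⟩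
  rcases lt_trichotomy k m with h | h | h
  · rw [compare_lt_iff_lt.mpr h]
    simp only [constraintCost]
    split_ifs with hp
    · exact bernoulliKL_le_of_ge_of_ge h0 h1 hp.le (by gcongr) (mem k hk).1
    · exact bernoulliKL_nonneg h0 h1 (mem k hk)
  · subst h
    simp [constraintCost]
  · rw [compare_gt_iff_gt.mpr h]
    simp only [constraintCost]
    split_ifs with hp
    · exact bernoulliKL_le_of_le_of_le h0 h1 hp.le (by gcongr) (mem k hk).2
    · exact bernoulliKL_nonneg h0 h1 (mem k hk)

/-! ### Binomial probabilities -/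

/-- The binomial probability of `k` successes in `n` trials. -/
def binomialProb (n : ℕ) (p : ℝ) (k : ℕ) : ℝ := n.choose k * (p ^ k * (1 - p) ^ (n - k))

lemma binomialProb_nonneg {p : ℝ} (h0 : 0 < p) (h1 : p < 1) (n k : ℕ) :
    0 ≤ binomialProb n p k := by
  have : 0 ≤ 1 - p := by linarith
  unfold binomialProb
  positivity

/-- For fixed `k`, the quantity `k ^ i / i!` is largest at `i = k`. -/
lemma factorial_mul_pow_le (k i : ℕ) : k.factorial * k ^ i ≤ i.factorial * k ^ k := by
  rcases le_total k i with h | h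
  · have := Nat.factorial_mul_pow_sub_le_factorial h
    calc k.factorial * k ^ i = k.factorial * k ^ (i - k) * k ^ k := by
          rw [mul_assoc, ← pow_add, Nat.sub_add_cancel h]
      _ ≤ i.factorial * k ^ k := Nat.mul_le_mul_right _ this
  · have h1 := Nat.factorial_mul_descFactorial (n := k) (k := k - i) (Nat.sub_le _ _)
    rw [Nat.sub_sub_self h] at h1
    calc k.factorial * k ^ i = i.factorial * k.descFactorial (k - i) * k ^ i := by rw [h1]
      _ ≤ i.factorial * k ^ (k - i) * k ^ i := by
          gcongr
          exact Nat.descFactorial_le_pow _ _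
      _ = i.factorial * k ^ k := by rw [mul_assoc, ← pow_add, Nat.sub_add_cancel h]

/-- The binomial law with success probability `k / n` has mode `k`, written in `ℕ` after
multiplication by `n ^ n`. Its mass at the mode is at most 1 and at least the average `1 / (n + 1)`,
which gives the next two lemmas. -/
lemma choose_mul_pow_le {n k i : ℕ} (hk : k ≤ n) (hi : i ≤ n) :
    k ^ i * (n - k) ^ (n - i) * n.choose i ≤ k ^ k * (n - k) ^ (n - k) * n.choose k := by
  have h1 := factorial_mul_pow_le k i
  have h2 := factorial_mul_pow_le (n - k) (n - i)
  have e1 := Nat.choose_mul_factorial_mul_factorial hk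
  have e2 := Nat.choose_mul_factorial_mul_factorial hi
  have hpos : 0 < k.factorial * (n - k).factorial * (i.factorial * (n - i).factorial) := by
    positivity
  refine Nat.le_of_mul_le_mul_left ?_ hpos
  calc _ = (k.factorial * k ^ i) * ((n - k).factorial * (n - k) ^ (n - i)) *
        (n.choose i * i.factorial * (n - i).factorial) := by ring
    _ ≤ (i.factorial * k ^ k) * ((n - i).factorial * (n - k) ^ (n - k)) *
        (n.choose i * i.factorial * (n - i).factorial) := by gcongr
    _ = (i.factorial * k ^ k) * ((n - i).factorial * (n - k) ^ (n - k)) *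
        (n.choose k * k.factorial * (n - k).factorial) := by rw [e1, e2]
    _ = _ := by ring

lemma choose_mul_pow_le_pow {n k : ℕ} (hk : k ≤ n) :
    k ^ k * (n - k) ^ (n - k) * n.choose k ≤ n ^ n := by
  have h := add_pow k (n - k) n
  rw [Nat.add_sub_cancel' hk] at h
  rw [h]
  exact Finset.single_le_sum (f := fun m => k ^ m * (n - k) ^ (n - m) * n.choose m)
    (fun _ _ => Nat.zero_le _) (mem_range.mpr (by omega))

lemma pow_le_choose_mul_pow {n k : ℕ} (hk : k ≤ n) :
    n ^ n ≤ (n + 1) * (k ^ k * (n - k) ^ (n - k) * n.choose k) := by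
  have h := add_pow k (n - k) n
  rw [Nat.add_sub_cancel' hk] at h
  rw [h]
  refine (Finset.sum_le_card_nsmul _ _ (k ^ k * (n - k) ^ (n - k) * n.choose k) ?_).trans ?_
  · intro i hi
    exact choose_mul_pow_le hk (by rw [mem_range] at hi; omega)
  · simp

/-- The exponential is the likelihood ratio, at `k` successes, of success probability `p` to `k /
n`. Without division, `0 ^ 0 = 1` covers `k = 0` and `k = n`. -/
lemma exp_neg_bernoulliKL_mul {p : ℝ} (h0 : 0 < p) (h1 : p < 1) {n k : ℕ} (hn : 0 < n)
    (hk : k ≤ n) :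
    Real.exp (-(n * bernoulliKL ((k : ℝ) / n) p)) * ((k : ℝ) ^ k * ((n - k : ℕ) : ℝ) ^ (n - k)) =
      p ^ k * (1 - p) ^ (n - k) * (n : ℝ) ^ n := by
  have hn' : (0 : ℝ) < n := by exact_mod_cast hn
  have h1' : 0 < 1 - p := by linarith
  have key : ∀ (i : ℕ) (q : ℝ), 0 < q →
      Real.exp (-(i * Real.log ((i : ℝ) / n / q))) * (i : ℝ) ^ i = q ^ i * (n : ℝ) ^ i := by
    intro i q hq
    rcases i.eq_zero_or_pos with rfl | hi
    · simp
    · have hi' : (0 : ℝ) < i := by exact_mod_cast hi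
      have : -(i * Real.log ((i : ℝ) / n / q)) = i * Real.log (q * n / i) := by
        rw [← mul_neg, ← Real.log_inv]
        congr 2
        field_simp
      rw [this, Real.exp_nat_mul, Real.exp_log (by positivity), ← mul_pow, ← mul_pow,
        div_mul_cancel₀ _ hi'.ne']
  have hsub : ((n - k : ℕ) : ℝ) / n = 1 - (k : ℝ) / n := by
    rw [Nat.cast_sub hk]
    field_simp
  have e1 := key k p h0
  have e2 := key (n - k) (1 - p) h1'
  rw [hsub] at e2
  have e3 : -(n * bernoulliKL ((k : ℝ) / n) p) =
      -(k * Real.log ((k : ℝ) / n / p)) +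
        -(((n - k : ℕ) : ℝ) * Real.log ((1 - (k : ℝ) / n) / (1 - p))) := by
    rw [bernoulliKL, Nat.cast_sub hk]
    field_simp
    ring
  rw [e3, Real.exp_add, mul_mul_mul_comm, e1, e2]
  have : (n : ℝ) ^ n = (n : ℝ) ^ k * (n : ℝ) ^ (n - k) := by
    rw [← pow_add, Nat.add_sub_cancel' hk]
  rw [this]
  ring

lemma pow_self_pos (k : ℕ) : (0 : ℝ) < (k : ℝ) ^ k := by
  rcases k.eq_zero_or_pos with rfl | hk
  · simp
  · positivity

lemma binomialProb_le {p : ℝ} (h0 : 0 < p) (h1 : p < 1) {n k : ℕ} (hn : 0 < n) (hk : k ≤ n) :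
    binomialProb n p k ≤ Real.exp (-(n * bernoulliKL ((k : ℝ) / n) p)) := by
  have h1' : 0 < 1 - p := by linarith
  have e := exp_neg_bernoulliKL_mul h0 h1 hn hk
  have hpos := mul_pos (pow_self_pos k) (pow_self_pos (n - k))
  have hle : (k : ℝ) ^ k * ((n - k : ℕ) : ℝ) ^ (n - k) * n.choose k ≤ (n : ℝ) ^ n := by
    exact_mod_cast choose_mul_pow_le_pow hk
  refine le_of_mul_le_mul_right ?_ hpos
  rw [e, binomialProb]
  calc _ = p ^ k * (1 - p) ^ (n - k) *
        ((k : ℝ) ^ k * ((n - k : ℕ) : ℝ) ^ (n - k) * n.choose k) := by ring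
    _ ≤ _ := by gcongr

lemma le_binomialProb {p : ℝ} (h0 : 0 < p) (h1 : p < 1) {n k : ℕ} (hn : 0 < n) (hk : k ≤ n) :
    Real.exp (-(n * bernoulliKL ((k : ℝ) / n) p)) / (n + 1) ≤ binomialProb n p k := by
  have h1' : 0 < 1 - p := by linarith
  have e := exp_neg_bernoulliKL_mul h0 h1 hn hk
  have hpos := mul_pos (pow_self_pos k) (pow_self_pos (n - k))
  have hle : (n : ℝ) ^ n ≤
      (n + 1) * ((k : ℝ) ^ k * ((n - k : ℕ) : ℝ) ^ (n - k) * n.choose k) := by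
    exact_mod_cast pow_le_choose_mul_pow hk
  rw [div_le_iff₀ (by positivity)]
  refine le_of_mul_le_mul_right ?_ hpos
  rw [e, binomialProb]
  calc _ ≤ p ^ k * (1 - p) ^ (n - k) *
        ((n + 1) * ((k : ℝ) ^ k * ((n - k : ℕ) : ℝ) ^ (n - k) * n.choose k)) := by gcongr
    _ = _ := by ring

end Entropy
/-! ### The law of the numbers of approvals -/

section Counts
variable {A : Type*} [Fintype A] (E : Environment A)

/-- The probability that `n` informative agents give `x j` approvals to every `j` when the
quality vector is `L`. -/
def Environment.countProb (n : ℕ) (L : E.Quality) (x : A → ℕ) : ℝ :=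
  ∏ j, binomialProb n (E.info j (L j)) (x j)

lemma Environment.countProb_nonneg (n : ℕ) (L : E.Quality) (x : A → ℕ) :
    0 ≤ E.countProb n L x :=
  prod_nonneg fun _ _ => binomialProb_nonneg (E.info_pos _ _) (E.info_lt_one _ _) _ _

/-- The possible numbers of approvals from `n` agents. -/
def countVectors (A : Type*) [Fintype A] [DecidableEq A] (n : ℕ) : Finset (A → ℕ) :=
  Fintype.piFinset fun _ => range (n + 1)

lemma mem_countVectors [DecidableEq A] {n : ℕ} {x : A → ℕ} :
    x ∈ countVectors A n ↔ ∀ j, x j ≤ n := by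
  simp [countVectors]

lemma card_countVectors [DecidableEq A] (n : ℕ) :
    #(countVectors A n) = (n + 1) ^ Fintype.card A := by
  simp [countVectors]

lemma approvals_le {A : Type*} {n : ℕ} (S : Fin n → Ballot A) (j : A) : approvals S j ≤ n := by
  simpa [approvals] using card_le_univ (α := Fin n) {i : Fin n | S i j = true}

lemma card_filter_approvals_eq [DecidableEq A] (n : ℕ) (x : A → ℕ) :
    #{S : Fin n → Signal A | approvals S = x} = ∏ j, n.choose (x j) := by
  have h : #(Fintype.piFinset fun j => powersetCard (x j) (univ : Finset (Fin n))) =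
      ∏ j, n.choose (x j) := by
    simp [Fintype.card_piFinset]
  rw [← h]
  refine card_nbij' (fun S j => {i | S i j = true}) (fun T i j => decide (i ∈ T j)) ?_ ?_ ?_ ?_
  · intro S hS
    simp only [coe_filter, mem_univ, true_and, Set.mem_ofPred_eq] at hS
    simp only [mem_coe, Fintype.mem_piFinset, mem_powersetCard, subset_univ, true_and]
    exact fun j => congrFun hS j
  · intro T hT
    simp only [mem_coe, Fintype.mem_piFinset, mem_powersetCard, subset_univ, true_and] at hT
    simp only [coe_filter, mem_univ, true_and, Set.mem_ofPred_eq]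
    funext j
    simp [approvals, hT j]
  · intro S _
    funext i j
    simp
  · intro T _
    funext j
    ext i
    simp

lemma Environment.prod_signalProb_eq {n : ℕ} (L : E.Quality) (S : Fin n → Signal A) :
    ∏ i, E.signalProb L (S i) = ∏ j, (E.info j (L j) ^ approvals S j *
      (1 - E.info j (L j)) ^ (n - approvals S j)) := by
  unfold Environment.signalProb
  rw [Finset.prod_comm]
  refine prod_congr rfl fun j _ => ?_
  rw [prod_ite, prod_const, prod_const]
  congr 2
  have := card_filter_add_card_filter_not (s := (univ : Finset (Fin n))) (fun i => S i j = true)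
  simp only [card_univ, Fintype.card_fin] at this
  unfold approvals
  omega

/-- The likelihood of a signal profile depends only on its counts, so profiles are grouped by
counts; the group sizes supply the binomial coefficients. -/
lemma Environment.sum_signal_profiles [DecidableEq A] (n : ℕ) (L : E.Quality) (F : (A → ℕ) → ℝ) :
    ∑ S : Fin n → Signal A, (∏ i, E.signalProb L (S i)) * F (approvals S) =
      ∑ x ∈ countVectors A n, E.countProb n L x * F x := by
  rw [← sum_fiberwise_of_maps_to (g := approvals) (t := countVectors A n)
    (fun S _ => mem_countVectors.mpr (approvals_le S))]
  refine sum_congr rfl fun x _ => ?_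
  have : ∀ S ∈ ({S : Fin n → Signal A | approvals S = x} : Finset _),
      (∏ i, E.signalProb L (S i)) * F (approvals S) = (∏ j, (E.info j (L j) ^ x j *
      (1 - E.info j (L j)) ^ (n - x j))) * F x := by
    intro S hS
    rw [mem_filter] at hS
    rw [E.prod_signalProb_eq, hS.2]
  rw [sum_congr rfl this, sum_const, card_filter_approvals_eq, nsmul_eq_mul, ← mul_assoc]
  congr 1
  simp only [Environment.countProb, binomialProb, prod_mul_distrib, Nat.cast_prod]

end Counts

/-! ### Large deviations -/

section Rates
variable {A : Type*} [Fintype A] [LinearOrder A] (E : Environment A) {a : A}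

lemma Environment.continuous_rateAt (P : Pattern a) (L : E.Quality) :
    Continuous fun t => E.rateAt P L t := by
  unfold Environment.rateAt
  refine (continuous_bernoulliKL (E.info_pos _ _) (E.info_lt_one _ _)).add
    (continuous_finsetSum _ fun j _ => ?_)
  simp only [constraintCost_eq (E.info_pos _ _) (E.info_lt_one _ _)]
  exact (continuous_bernoulliKL (E.info_pos _ _) (E.info_lt_one _ _)).comp
    (continuous_cheapest _ _)

lemma Environment.rate_le_rateAt (P : Pattern a) (L : E.Quality) {t : ℝ}
    (ht : t ∈ Set.Icc (0 : ℝ) 1) : E.rate P L ≤ E.rateAt P L t := by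
  refine csInf_le ⟨0, ?_⟩ ⟨t, ht, rfl⟩
  rintro _ ⟨u, hu, rfl⟩
  exact add_nonneg (bernoulliKL_nonneg (E.info_pos _ _) (E.info_lt_one _ _) hu)
    (sum_nonneg fun j _ => constraintCost_nonneg (E.info_pos _ _) (E.info_lt_one _ _) _ hu)

/-- An interior threshold leaves room to round and shift the counts without leaving `{0, …, n}`;
continuity makes it almost optimal. -/
lemma Environment.exists_rateAt_lt (P : Pattern a) (L : E.Quality) {r : ℝ} (hr : E.rate P L < r) :
    ∃ t ∈ Set.Ioo (0 : ℝ) 1, E.rateAt P L t < r := by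
  obtain ⟨_, ⟨t, ht, rfl⟩, htr⟩ := exists_lt_of_csInf_lt
    (Set.Nonempty.image _ ⟨0, by simp⟩) hr
  rw [← closure_Ioo zero_ne_one] at ht
  obtain ⟨u, hu, hu'⟩ := mem_closure_iff.mp ht _
    (isOpen_lt (E.continuous_rateAt P L) continuous_const) htr
  exact ⟨u, hu', hu⟩

/-- The probability that `n` informative agents, together with the quality vector, realize a pair
in `T`, for the uniform weights on the quality vectors. -/
def Environment.mass (T : Set (Pattern a × E.Quality)) (n : ℕ) : ℝ :=
  ∑ L : E.Quality, ∑ x ∈ countVectors A n,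
    E.countProb n L x * T.indicator 1 (patternOf a x, L)

lemma Environment.rate_le_sum (L : E.Quality) {n : ℕ} (hn : 0 < n) {x : A → ℕ}
    (hx : x ∈ countVectors A n) :
    E.rate (patternOf a x) L ≤ ∑ j, bernoulliKL ((x j : ℝ) / n) (E.info j (L j)) := by
  rw [mem_countVectors] at hx
  have hn' : (0 : ℝ) < n := by exact_mod_cast hn
  refine (E.rate_le_rateAt (patternOf a x) L (t := (x a : ℝ) / n)
    ⟨by positivity, (div_le_one hn').mpr (by exact_mod_cast hx a)⟩).trans ?_
  rw [Fintype.sum_eq_add_sum_subtype_ne _ a, Environment.rateAt]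
  gcongr with j
  exact constraintCost_compare_le (E.info_pos _ _) (E.info_lt_one _ _) hn (hx j) (hx a)

/-- Each term is at most `exp (-n * r)`, by the upper binomial bound at threshold `x a / n`, and the
number of terms is polynomial in `n`. -/
lemma Environment.mass_le {T : Set (Pattern a × E.Quality)} {r : ℝ}
    (hr : ∀ PL ∈ T, r ≤ E.rate PL.1 PL.2) {n : ℕ} (hn : 0 < n) :
    E.mass T n ≤ Fintype.card E.Quality * ((n + 1 : ℝ) ^ Fintype.card A * Real.exp (-(n * r))) := by
  have key : ∀ L : E.Quality, ∀ x ∈ countVectors A n,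
      E.countProb n L x * T.indicator 1 (patternOf a x, L) ≤ Real.exp (-(n * r)) := by
    intro L x hx
    by_cases hT : (patternOf a x, L) ∈ T
    · rw [Set.indicator_of_mem hT, Pi.one_apply, mul_one]
      calc E.countProb n L x
          ≤ ∏ j, Real.exp (-(n * bernoulliKL ((x j : ℝ) / n) (E.info j (L j)))) :=
            prod_le_prod
              (fun _ _ => binomialProb_nonneg (E.info_pos _ _) (E.info_lt_one _ _) _ _)
              fun j _ => binomialProb_le (E.info_pos _ _) (E.info_lt_one _ _) hn
                (mem_countVectors.mp hx j)
        _ = Real.exp (-(n * ∑ j, bernoulliKL ((x j : ℝ) / n) (E.info j (L j)))) := by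
            rw [← Real.exp_sum, mul_sum, sum_neg_distrib]
        _ ≤ Real.exp (-(n * r)) := by
            gcongr
            exact (hr _ hT).trans (E.rate_le_sum L hn hx)
    · rw [Set.indicator_of_notMem hT, mul_zero]
      positivity
  unfold Environment.mass
  calc _ ≤ ∑ L : E.Quality, ∑ x ∈ countVectors A n, Real.exp (-(n * r)) :=
        sum_le_sum fun L _ => sum_le_sum fun x hx => key L x hx
    _ = _ := by simp [card_countVectors]

/-- Move a number of approvals so that it satisfies a constraint strictly. -/
def shift (o : Ordering) (k : ℕ) : ℕ :=
  match o with
  | .eq => k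
  | .gt => k + 1
  | .lt => k - 1

lemma tendsto_shift_div (o : Ordering) {u : ℝ} (hu : 0 ≤ u) :
    Tendsto (fun n : ℕ => (shift o ⌊u * n⌋₊ : ℝ) / n) atTop (nhds u) := by
  have h1 : Tendsto (fun n : ℕ => (⌊u * n⌋₊ : ℝ) / n) atTop (nhds u) :=
    (tendsto_nat_floor_mul_div_atTop hu).comp tendsto_natCast_atTop_atTop
  have h2 : Tendsto (fun n : ℕ => 1 / (n : ℝ)) atTop (nhds 0) := tendsto_one_div_atTop_nhds_zero_nat
  have h3 := h1.sub h2
  have h4 := h1.add h2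
  rw [sub_zero] at h3
  rw [add_zero] at h4
  refine tendsto_of_tendsto_of_tendsto_of_le_of_le h3 h4 (fun n => ?_) (fun n => ?_)
  · have : (⌊u * n⌋₊ : ℝ) - 1 ≤ shift o ⌊u * n⌋₊ := by
      have : ⌊u * n⌋₊ ≤ shift o ⌊u * n⌋₊ + 1 := by
        cases o <;> simp only [shift] <;> omega
      rw [sub_le_iff_le_add]
      exact_mod_cast this
    simp only [← sub_div]
    gcongr
  · have : (shift o ⌊u * n⌋₊ : ℝ) ≤ ⌊u * n⌋₊ + 1 := by
      have : shift o ⌊u * n⌋₊ ≤ ⌊u * n⌋₊ + 1 := by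
        cases o <;> simp only [shift] <;> omega
      exact_mod_cast this
    simp only [← add_div]
    gcongr

lemma compare_shift {p t : ℝ} (o : Ordering) {n : ℕ} (hn : 1 ≤ t * n) :
    compare (shift o ⌊cheapest o t p * n⌋₊) ⌊t * n⌋₊ = o := by
  -- The `.lt` case needs this, because the subtraction in `shift` is truncated at zero.
  have h1 : 1 ≤ ⌊t * n⌋₊ := Nat.one_le_floor_iff _ |>.mpr hn
  cases o
  · have : ⌊cheapest .lt t p * n⌋₊ ≤ ⌊t * n⌋₊ := by
      simp only [cheapest]
      gcongr
      exact min_le_left _ _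
    rw [compare_lt_iff_lt]
    simp only [shift]
    omega
  · simp [shift, cheapest]
  · have : ⌊t * n⌋₊ ≤ ⌊cheapest .gt t p * n⌋₊ := by
      simp only [cheapest]
      gcongr
      exact le_max_left _ _
    rw [compare_gt_iff_gt]
    simp only [shift]
    omega

lemma eventually_mul_pow_lt_exp (K : ℝ) (m : ℕ) {ε : ℝ} (hε : 0 < ε) :
    ∀ᶠ n : ℕ in atTop, K * (n + 1 : ℝ) ^ m < Real.exp (n * ε) := by
  have h1 := (Real.tendsto_pow_mul_exp_neg_atTop_nhds_zero m).comp
    (tendsto_atTop_add_const_right atTop ε (tendsto_natCast_atTop_atTop.atTop_mul_const hε))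
  -- The limit is that of `y ^ m * exp (-y)` at `y = (n + 1) * ε`; this constant undoes the
  -- rescaling.
  have h2 := h1.const_mul (K * Real.exp ε / ε ^ m)
  rw [mul_zero] at h2
  filter_upwards [h2.eventually_lt_const one_pos] with n hn
  simp only [Function.comp_apply] at hn
  have e1 : (n * ε + ε) = (n + 1) * ε := by ring
  have e2 : Real.exp (-((n + 1) * ε)) = (Real.exp ε)⁻¹ * (Real.exp (n * ε))⁻¹ := by
    rw [← Real.exp_neg, ← Real.exp_neg, ← Real.exp_add]
    congr 1
    ring
  rw [e1, e2, mul_pow] at hn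
  have e3 : K * Real.exp ε / ε ^ m *
      ((n + 1 : ℝ) ^ m * ε ^ m * ((Real.exp ε)⁻¹ * (Real.exp (n * ε))⁻¹)) =
      K * (n + 1 : ℝ) ^ m / Real.exp (n * ε) := by
    have := (Real.exp_pos ε).ne'
    field_simp
  rw [e3, div_lt_one (Real.exp_pos _)] at hn
  exact hn

/-- A single count vector suffices: every alternative is put at its cheapest frequency for a nearly
optimal threshold, then shifted by one where its inequality must be strict. The shift is negligible
relative to `n`. -/
lemma Environment.eventually_le_mass {T : Set (Pattern a × E.Quality)} {P : Pattern a}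
    {L : E.Quality} (hT : (P, L) ∈ T) {r : ℝ} (hr : E.rate P L < r) :
    ∀ᶠ n : ℕ in atTop, Real.exp (-(n * r)) ≤ E.mass T n := by
  -- The gap below `r'` absorbs rounding and the choice of threshold; the gap above it absorbs the
  -- factor `(n + 1) ^ card A`.
  obtain ⟨r', hr', hr'r⟩ := exists_between hr
  obtain ⟨t, ht, htr⟩ := E.exists_rateAt_lt P L hr'
  set o : A → Ordering := fun j => if h : j = a then .eq else P ⟨j, h⟩ with ho
  have hoa : o a = .eq := by simp [ho]
  set u : A → ℝ := fun j => cheapest (o j) t (E.info j (L j)) with hu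
  have hu01 : ∀ j, u j ∈ Set.Ioo (0 : ℝ) 1 := fun j =>
    cheapest_mem_Ioo (E.info_pos _ _) (E.info_lt_one _ _) _ ht
  set x : ℕ → A → ℕ := fun n j => shift (o j) ⌊u j * n⌋₊ with hx
  have hlim : ∀ j, Tendsto (fun n => (x n j : ℝ) / n) atTop (nhds (u j)) := fun j =>
    tendsto_shift_div _ (hu01 j).1.le
  have hrate : ∑ j, bernoulliKL (u j) (E.info j (L j)) = E.rateAt P L t := by
    rw [Fintype.sum_eq_add_sum_subtype_ne _ a, Environment.rateAt]
    congr 1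
    · simp [hu, hoa, cheapest]
    · refine sum_congr rfl fun j _ => ?_
      rw [constraintCost_eq (E.info_pos _ _) (E.info_lt_one _ _)]
      simp [hu, ho, j.2]
  have hsum : Tendsto (fun n => ∑ j, bernoulliKL ((x n j : ℝ) / n) (E.info j (L j))) atTop
      (nhds (E.rateAt P L t)) := by
    rw [← hrate]
    exact tendsto_finsetSum _ fun j _ =>
      ((continuous_bernoulliKL (E.info_pos _ _) (E.info_lt_one _ _)).tendsto _).comp (hlim j)
  have hle : ∀ᶠ n in atTop, ∀ j, (x n j : ℝ) / n < 1 :=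
    eventually_all.mpr fun j => (hlim j).eventually_lt_const (hu01 j).2
  have hone : ∀ᶠ n : ℕ in atTop, 1 ≤ t * n :=
    (tendsto_natCast_atTop_atTop.const_mul_atTop ht.1).eventually_ge_atTop 1
  filter_upwards [hle, hone, hsum.eventually_lt_const htr, eventually_gt_atTop 0,
    eventually_mul_pow_lt_exp 1 (Fintype.card A) (sub_pos.mpr hr'r)] with n hle hone hsum hn hpow
  have hn' : (0 : ℝ) < n := by exact_mod_cast hn
  have hxn : ∀ j, x n j ≤ n := fun j => by
    have := (div_lt_one hn').mp (hle j)
    exact_mod_cast this.le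
  have hpat : patternOf a (x n) = P := by
    funext j
    have hxa : x n a = ⌊t * n⌋₊ := by simp [hx, hu, hoa, shift, cheapest]
    have hoj : o j = P j := by simp [ho, j.2]
    rw [patternOf, hxa, ← hoj]
    exact compare_shift _ hone
  have hterm : ∀ (L' : E.Quality) (y : A → ℕ),
      0 ≤ E.countProb n L' y * T.indicator 1 (patternOf a y, L') := fun L' y =>
    mul_nonneg (E.countProb_nonneg _ _ _) (Set.indicator_nonneg (fun _ _ => zero_le_one) _)
  calc Real.exp (-(n * r))
      ≤ Real.exp (-(n * r')) / (n + 1 : ℝ) ^ Fintype.card A := by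
        rw [le_div_iff₀ (by positivity)]
        rw [one_mul] at hpow
        calc _ ≤ Real.exp (-(n * r)) * Real.exp (n * (r - r')) := by gcongr
          _ = _ := by
            rw [← Real.exp_add]
            congr 1
            ring
    _ ≤ Real.exp (-(n * ∑ j, bernoulliKL ((x n j : ℝ) / n) (E.info j (L j)))) /
          (n + 1 : ℝ) ^ Fintype.card A := by gcongr
    _ = ∏ j, (Real.exp (-(n * bernoulliKL ((x n j : ℝ) / n) (E.info j (L j)))) / (n + 1)) := by
        rw [prod_div_distrib, ← Real.exp_sum, mul_sum, sum_neg_distrib, prod_const, card_univ]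
    _ ≤ E.countProb n L (x n) :=
        prod_le_prod (fun _ _ => by positivity) fun j _ =>
          le_binomialProb (E.info_pos _ _) (E.info_lt_one _ _) hn (hxn j)
    _ = E.countProb n L (x n) * T.indicator 1 (patternOf a (x n), L) := by
        rw [hpat, Set.indicator_of_mem hT, Pi.one_apply, mul_one]
    _ ≤ ∑ y ∈ countVectors A n, E.countProb n L y * T.indicator 1 (patternOf a y, L) :=
        single_le_sum (f := fun y => E.countProb n L y * T.indicator 1 (patternOf a y, L))
          (fun y _ => hterm L y) (mem_countVectors.mpr hxn)
    _ ≤ E.mass T n :=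
        single_le_sum (f := fun L' => ∑ y ∈ countVectors A n,
          E.countProb n L' y * T.indicator 1 (patternOf a y, L'))
          (fun L' _ => sum_nonneg fun y _ => hterm L' y) (mem_univ L)

lemma Environment.eventually_mul_mass_lt_mass {T T' : Set (Pattern a × E.Quality)} {P : Pattern a}
    {L : E.Quality} (hT : (P, L) ∈ T) {r : ℝ} (hr : E.rate P L < r)
    (hT' : ∀ PL ∈ T', r ≤ E.rate PL.1 PL.2) {K : ℝ} (hK : 0 ≤ K) :
    ∀ᶠ n : ℕ in atTop, K * E.mass T' n < E.mass T n := by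
  obtain ⟨r', hr', hr'r⟩ := exists_between hr
  filter_upwards [E.eventually_le_mass hT hr', eventually_gt_atTop 0,
    eventually_mul_pow_lt_exp (K * Fintype.card E.Quality) (Fintype.card A) (sub_pos.mpr hr'r)]
    with n h1 hn hpow
  refine lt_of_lt_of_le ?_ h1
  calc K * E.mass T' n
      ≤ K * (Fintype.card E.Quality * ((n + 1 : ℝ) ^ Fintype.card A * Real.exp (-(n * r)))) := by
        gcongr
        exact E.mass_le hT' hn
    _ = K * Fintype.card E.Quality * (n + 1 : ℝ) ^ Fintype.card A * Real.exp (-(n * r)) := by ring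
    _ < Real.exp (n * (r - r')) * Real.exp (-(n * r)) := by gcongr
    _ = Real.exp (-(n * r')) := by
        rw [← Real.exp_add]
        congr 1
        ring

end Rates
/-! ### Equilibrium conditions -/

section Equilibrium
variable {A : Type*} [Fintype A] (E : Environment A)

lemma sum_filter_zero_eq {Ω : Type*} [Fintype Ω] [DecidableEq Ω] {n : ℕ} (s : Ω)
    (f : (Fin (n + 1) → Ω) → ℝ) :
    ∑ S : Fin (n + 1) → Ω with S 0 = s, f S = ∑ S : Fin n → Ω, f (Fin.cons s S) := by
  refine sum_nbij' (fun S => Fin.tail S) (fun S => Fin.cons s S) ?_ ?_ ?_ ?_ ?_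
  · simp
  · simp
  · intro S hS
    rw [mem_filter] at hS
    rw [← hS.2, Fin.cons_self_tail]
  · simp
  · intro S hS
    rw [mem_filter] at hS
    rw [← hS.2, Fin.cons_self_tail]

lemma approvals_cons {A : Type*} {n : ℕ} (b : Ballot A) (S : Fin n → Ballot A) (j : A) :
    approvals (Fin.cons b S : Fin (n + 1) → Ballot A) j =
      approvals S j + if b j = true then 1 else 0 := by
  unfold approvals
  rw [Fin.card_filter_univ_succ]
  simp only [Fin.cons_zero, Fin.cons_succ]
  split_ifs <;> simp

/-- The weight of the quality vector `L` for an agent with signals `s`. -/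
def Environment.weight (s : Signal A) (L : E.Quality) : ℝ :=
  (∏ j, E.prior j (L j)) * E.signalProb L s

lemma Environment.signalProb_pos (L : E.Quality) (s : Signal A) : 0 < E.signalProb L s := by
  refine prod_pos fun j _ => ?_
  split_ifs
  · exact E.info_pos _ _
  · linarith [E.info_lt_one j (L j)]

lemma Environment.weight_pos (hprior : ∀ j ℓ, 0 < E.prior j ℓ) (s : Signal A) (L : E.Quality) :
    0 < E.weight s L :=
  mul_pos (prod_pos fun _ _ => hprior _ _) (E.signalProb_pos L s)

lemma Environment.jointProb_cons {n : ℕ} (L : E.Quality) (s : Signal A) (S : Fin n → Signal A) :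
    E.jointProb L (Fin.cons s S : Fin (n + 1) → Signal A) =
      E.weight s L * ∏ i, E.signalProb L (S i) := by
  unfold Environment.jointProb Environment.weight
  rw [Fin.prod_univ_succ]
  simp only [Fin.cons_zero, Fin.cons_succ]
  ring

lemma Environment.utility_eq_sum (hunit : ∀ j, E.cost j = 1) (L : E.Quality) (W : Finset A) :
    E.utility L W = ∑ j ∈ W, ((L j : ℕ) : ℝ) := by
  unfold Environment.utility
  split <;> simp [hunit]

variable [LinearOrder A]

/-- The utility of the ballot `b` to an agent with signals `s`, when `n` other agents vote
informatively, up to normalization. -/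
def Environment.score (n : ℕ) (s : Signal A) (b : Ballot A) : ℝ :=
  ∑ L : E.Quality, E.weight s L * ∑ x ∈ countVectors A n, E.countProb n L x *
    E.utility L (E.avOfCounts fun j => x j + if b j = true then 1 else 0)

lemma Environment.sum_jointProb_mul_utility {n : ℕ} {s : Signal A} {b : Ballot A}
    {σ : Fin (n + 1) → Strategy A} (hσ : σ 0 s = b) (hσ' : ∀ i : Fin n, σ i.succ = id) :
    ∑ L : E.Quality, ∑ S : Fin (n + 1) → Signal A with S 0 = s,
      E.jointProb L S * E.utility L (E.av fun k => σ k (S k)) = E.score n s b := by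
  refine sum_congr rfl fun L _ => ?_
  rw [sum_filter_zero_eq, ← E.sum_signal_profiles n L
    fun x => E.utility L (E.avOfCounts fun j => x j + if b j = true then 1 else 0), mul_sum]
  refine sum_congr rfl fun S _ => ?_
  have h : (fun k => σ k ((Fin.cons s S : Fin (n + 1) → Signal A) k)) =
      (Fin.cons b S : Fin (n + 1) → Ballot A) := by
    funext k
    refine Fin.cases ?_ (fun i => ?_) k
    · simpa using hσ
    · simp [hσ' i]
  rw [h, E.jointProb_cons, mul_assoc, Environment.av]
  congr 4
  funext j
  exact approvals_cons b S j

lemma Environment.IsBNE.score_le {n : ℕ} (hprior : ∀ j ℓ, 0 < E.prior j ℓ)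
    (h : E.IsBNE (informative A (n + 1))) (s : Signal A) (b : Ballot A) :
    E.score n s b ≤ E.score n s s := by
  -- The deviation may be a constant strategy, since only its value at `s` matters. The normalizing
  -- denominators agree and are positive.
  have h0 := h 0 s fun _ => b
  unfold Environment.expectedUtility at h0
  rw [E.sum_jointProb_mul_utility (b := b) (by simp) (fun i => by
      rw [Function.update_of_ne (Fin.succ_ne_zero i)]
      rfl),
    E.sum_jointProb_mul_utility (b := s) rfl (fun i => rfl)] at h0
  refine (div_le_div_iff_of_pos_right ?_).mp h0
  refine sum_pos (fun L _ => ?_) ⟨fun _ => 0, mem_univ _⟩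
  rw [sum_filter_zero_eq]
  refine sum_pos (fun S _ => ?_) ⟨fun _ => s, mem_univ _⟩
  rw [E.jointProb_cons]
  exact mul_pos (E.weight_pos hprior s L) (prod_pos fun _ _ => E.signalProb_pos _ _)

variable (hunit : ∀ j, E.cost j = 1) (hbudget : E.budget < Fintype.card A)
  {a : A} (ha : ∀ j, a ≤ j)

/-- The effect of one more approval for `a` on the utility. -/
def Environment.gain (a : A) (L : E.Quality) (x : A → ℕ) : ℝ :=
  E.utility L (E.avOfCounts (bump a x)) - E.utility L (E.avOfCounts x)

include hunit in
lemma Environment.Replaces.gain_eq {L : E.Quality} {x : A → ℕ} {j : A}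
    (h : E.Replaces (patternOf a x) j) :
    E.gain a L x = ((L a : ℕ) : ℝ) - ((L j : ℕ) : ℝ) := by
  obtain ⟨h1, h2, h3⟩ := h x (follows_iff.mpr rfl)
  rw [Environment.gain, bump, h3, E.utility_eq_sum hunit, E.utility_eq_sum hunit,
    sum_insert (by simp [h2]), ← add_sum_erase _ _ h1]
  ring

include hunit hbudget ha in
lemma Environment.gain_bounds (L : E.Quality) (x : A → ℕ) :
    (E.PivPlus a).indicator 1 (patternOf a x, L) -
        E.maxQuality * (E.PivMinus a).indicator 1 (patternOf a x, L) ≤ E.gain a L x ∧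
      E.gain a L x ≤ E.maxQuality * (E.PivPlus a).indicator 1 (patternOf a x, L) -
        (E.PivMinus a).indicator 1 (patternOf a x, L) := by
  have hmax : ∀ i, ((L i : ℕ) : ℝ) ≤ E.maxQuality := fun i => by
    exact_mod_cast Nat.lt_succ_iff.mp (L i).2
  have hnn : ∀ i, (0 : ℝ) ≤ ((L i : ℕ) : ℝ) := fun i => Nat.cast_nonneg _
  -- Qualities are integers, so a strict inequality gives a gap of at least 1; this is the constant
  -- 1 in both bounds.
  have hlt : ∀ i k, L i < L k → ((L i : ℕ) : ℝ) + 1 ≤ ((L k : ℕ) : ℝ) := fun i k h => by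
    exact_mod_cast h
  have hplus : (patternOf a x, L) ∈ E.PivPlus a →
      1 ≤ E.gain a L x ∧ E.gain a L x ≤ E.maxQuality := by
    rintro ⟨j, hj, hL⟩
    rw [hj.gain_eq E hunit]
    constructor <;> linarith [hlt _ _ hL, hmax a, hnn j]
  have hminus : (patternOf a x, L) ∈ E.PivMinus a →
      E.gain a L x ≤ -1 ∧ -E.maxQuality ≤ E.gain a L x := by
    rintro ⟨j, hj, hL⟩
    rw [hj.gain_eq E hunit]
    constructor <;> linarith [hlt _ _ hL, hmax j, hnn a]
  by_cases h1 : (patternOf a x, L) ∈ E.PivPlus a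
  · have h2 : (patternOf a x, L) ∉ E.PivMinus a := fun h2 => by
      linarith [(hplus h1).1, (hminus h2).1]
    rw [Set.indicator_of_mem h1, Set.indicator_of_notMem h2]
    simpa using hplus h1
  · by_cases h2 : (patternOf a x, L) ∈ E.PivMinus a
    · rw [Set.indicator_of_notMem h1, Set.indicator_of_mem h2]
      simpa using (hminus h2).symm
    · have h0 : E.gain a L x = 0 := by
        rcases E.avOfCounts_bump_eq_or_replaces hunit hbudget ha x with h | ⟨j, hj⟩
        · rw [Environment.gain, h, sub_self]
        · have e1 : ¬ L j < L a := fun h => h1 ⟨j, hj, h⟩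
          have e2 : ¬ L a < L j := fun h => h2 ⟨j, hj, h⟩
          rw [hj.gain_eq E hunit, le_antisymm (not_lt.mp e1) (not_lt.mp e2), sub_self]
      rw [Set.indicator_of_notMem h1, Set.indicator_of_notMem h2, h0]
      simp

/-- The ballot that approves exactly `a`. -/
def approveOnly (a : A) : Ballot A := fun j => decide (j = a)

lemma Environment.score_sub_score (a : A) (n : ℕ) (s : Signal A) :
    E.score n s (approveOnly a) - E.score n s (fun _ => false) =
      ∑ L : E.Quality, ∑ x ∈ countVectors A n,
        E.weight s L * E.countProb n L x * E.gain a L x := by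
  unfold Environment.score
  rw [← sum_sub_distrib]
  refine sum_congr rfl fun L _ => ?_
  rw [← mul_sub, ← sum_sub_distrib, mul_sum]
  refine sum_congr rfl fun x _ => ?_
  have e1 : (fun j => x j + if approveOnly a j = true then 1 else 0) = bump a x := by
    funext j
    by_cases hj : j = a
    · subst hj
      simp [approveOnly]
    · simp [approveOnly, hj]
  rw [e1, mul_assoc, ← mul_sub]
  simp [Environment.gain]

lemma Environment.sum_const_mul_eq (c : ℝ) (T : Set (Pattern a × E.Quality)) (n : ℕ) :
    ∑ L : E.Quality, ∑ x ∈ countVectors A n,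
      c * (E.countProb n L x * T.indicator 1 (patternOf a x, L)) = c * E.mass T n := by
  simp only [Environment.mass, mul_sum]

include hunit hbudget ha in
/-- If informative voting is an equilibrium, then the favourable and the unfavourable pivotal
events have comparable probabilities. -/
lemma Environment.exists_mass_le (hprior : ∀ j ℓ, 0 < E.prior j ℓ) :
    ∃ K : ℝ, 0 ≤ K ∧ ∀ n : ℕ, E.IsBNE (informative A (n + 1)) →
      E.mass (E.PivPlus a) n ≤ K * E.mass (E.PivMinus a) n ∧
      E.mass (E.PivMinus a) n ≤ K * E.mass (E.PivPlus a) n := by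
  -- Signal vectors and quality vectors are finite in number, so the extreme weights are attained;
  -- they do not involve `n`.
  set w : Signal A × E.Quality → ℝ := fun p => E.weight p.1 p.2
  obtain ⟨p, hp⟩ := Finite.exists_min w
  obtain ⟨q, hq⟩ := Finite.exists_max w
  have hc : 0 < w p := E.weight_pos hprior _ _
  have hC : 0 < w q := E.weight_pos hprior _ _
  have hM : (0 : ℝ) ≤ E.maxQuality := Nat.cast_nonneg _
  have hind : ∀ (T : Set (Pattern a × E.Quality)) (y : Pattern a × E.Quality),
      0 ≤ T.indicator (1 : Pattern a × E.Quality → ℝ) y := fun T y =>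
    Set.indicator_nonneg (fun _ _ => zero_le_one) _
  refine ⟨w q * E.maxQuality / w p, by positivity, fun n hn => ?_⟩
  have bound : ∀ (s : Signal A) (L : E.Quality) (x : A → ℕ) (d e : ℝ), 0 ≤ d → 0 ≤ e →
      w p * (E.countProb n L x * d) - w q * E.maxQuality * (E.countProb n L x * e) ≤
        E.weight s L * E.countProb n L x * (d - E.maxQuality * e) := by
    intro s L x d e hd he
    have hcp := E.countProb_nonneg n L x
    have e1 : w p * (E.countProb n L x * d) ≤ E.weight s L * (E.countProb n L x * d) :=
      mul_le_mul_of_nonneg_right (hp (s, L)) (by positivity)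
    have e2 : E.weight s L * (E.maxQuality * (E.countProb n L x * e)) ≤
        w q * (E.maxQuality * (E.countProb n L x * e)) :=
      mul_le_mul_of_nonneg_right (hq (s, L)) (by positivity)
    linarith
  have conclude : ∀ (T T' : Set (Pattern a × E.Quality)) (s : Signal A)
      (g : E.Quality → (A → ℕ) → ℝ),
      (∀ L x, T.indicator 1 (patternOf a x, L) -
        E.maxQuality * T'.indicator 1 (patternOf a x, L) ≤ g L x) →
      ∑ L : E.Quality, ∑ x ∈ countVectors A n, E.weight s L * E.countProb n L x * g L x ≤ 0 →
      E.mass T n ≤ w q * E.maxQuality / w p * E.mass T' n := by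
    intro T T' s g hg hsum
    have : w p * E.mass T n - w q * E.maxQuality * E.mass T' n ≤ 0 := by
      refine le_trans ?_ hsum
      rw [← E.sum_const_mul_eq, ← E.sum_const_mul_eq, ← sum_sub_distrib]
      refine sum_le_sum fun L _ => ?_
      rw [← sum_sub_distrib]
      refine sum_le_sum fun x _ => ?_
      refine (bound s L x _ _ (hind _ _) (hind _ _)).trans ?_
      exact mul_le_mul_of_nonneg_left (hg L x)
        (mul_nonneg (E.weight_pos hprior s L).le (E.countProb_nonneg n L x))
    rw [div_mul_eq_mul_div, le_div_iff₀ hc]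
    linarith
  constructor
  -- An agent without positive signals must not gain by approving `a`.
  · refine conclude _ _ (fun _ => false) (E.gain a)
      (fun L x => (E.gain_bounds hunit hbudget ha L x).1) ?_
    rw [← E.score_sub_score]
    linarith [hn.score_le E hprior (fun _ => false) (approveOnly a)]
  -- An agent whose only positive signal is about `a` must not gain by the empty ballot.
  · refine conclude _ _ (approveOnly a) (fun L x => -E.gain a L x)
      (fun L x => by linarith [(E.gain_bounds hunit hbudget ha L x).2]) ?_
    simp only [mul_neg, sum_neg_distrib]
    rw [← E.score_sub_score]
    linarith [hn.score_le E hprior (approveOnly a) (fun _ => false)]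

include hunit hbudget ha in
-- One replacing pattern serves both sets: `a` gets one extreme quality and all other alternatives
-- the opposite one.
lemma Environment.piv_nonempty (hquality : 1 ≤ E.maxQuality) :
    (E.PivPlus a).Nonempty ∧ (E.PivMinus a).Nonempty := by
  obtain ⟨P, j, hja, hj⟩ := E.exists_replaces hunit hbudget ha
  have h01 : (0 : Fin (E.maxQuality + 1)) < Fin.last E.maxQuality := by
    rw [Fin.lt_def]
    exact hquality
  exact ⟨⟨(P, fun k => if k = a then Fin.last _ else 0), j, hj, by simpa [hja] using h01⟩,
    ⟨(P, fun k => if k = a then 0 else Fin.last _), j, hj, by simpa [hja] using h01⟩⟩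

lemma isLeast_sInf_image {α : Type*} [Finite α] {T : Set α} (hT : T.Nonempty) (f : α → ℝ) :
    IsLeast (f '' T) (sInf (f '' T)) :=
  have hfin : (f '' T).Finite := T.toFinite.image f
  ⟨(hT.image f).csInf_mem hfin, fun _ hr => csInf_le hfin.bddBelow hr⟩

lemma Environment.le_of_frequently_mass_le {T T' : Set (Pattern a × E.Quality)} {r r' K : ℝ}
    (hr : IsLeast ((fun PL => E.rate PL.1 PL.2) '' T) r)
    (hr' : IsLeast ((fun PL => E.rate PL.1 PL.2) '' T') r') (hK : 0 ≤ K)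
    (h : ∃ᶠ n in atTop, E.mass T n ≤ K * E.mass T' n) : r' ≤ r := by
  by_contra! hlt
  obtain ⟨⟨P, L⟩, hT, hPL⟩ := hr.1
  have hev := E.eventually_mul_mass_lt_mass hT (r := r') (hPL.trans_lt hlt)
    (fun PL hPL' => hr'.2 ⟨PL, hPL', rfl⟩) hK
  obtain ⟨n, hn, hn'⟩ := (h.and_eventually hev).exists
  exact hn.not_gt hn'

end Equilibrium
end EpistemicPB
end

theorem theorem7 {A : Type*} [Fintype A] [LinearOrder A] (E : EpistemicPB.Environment A)
    (hunit : ∀ j, E.cost j = 1)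
    (hbudget : E.budget < Fintype.card A)
    (hquality : 1 ≤ E.maxQuality)
    (hprior : ∀ j ℓ, 0 < E.prior j ℓ)
    (a : A) (ha : ∀ j, a ≤ j) :
    IsLeast (E.ratesPlus a) (E.GPlusMin a) ∧
    IsLeast (E.ratesMinus a) (E.GMinusMin a) ∧
    ((∃ᶠ n : ℕ in Filter.atTop, E.IsBNE (EpistemicPB.informative A n)) →
      E.GMinusMin a = E.GPlusMin a) := by
  obtain ⟨hne, hne'⟩ := E.piv_nonempty hunit hbudget ha hquality
  have hplus : IsLeast (E.ratesPlus a) (E.GPlusMin a) :=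
    EpistemicPB.isLeast_sInf_image hne _
  have hminus : IsLeast (E.ratesMinus a) (E.GMinusMin a) :=
    EpistemicPB.isLeast_sInf_image hne' _
  refine ⟨hplus, hminus, fun hfreq => ?_⟩
  obtain ⟨K, hK, hmass⟩ := E.exists_mass_le hunit hbudget ha hprior
  -- The masses count the `n` other agents, so the electorate has `n + 1`; starting from `N + 1`
  -- excludes an empty one.
  have hsucc : ∃ᶠ n in atTop, E.IsBNE (EpistemicPB.informative A (n + 1)) := by
    rw [frequently_atTop] at hfreq ⊢
    intro N
    obtain ⟨n, hn, h⟩ := hfreq (N + 1)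
    obtain ⟨m, rfl⟩ : ∃ m, n = m + 1 := ⟨n - 1, by omega⟩
    exact ⟨m, by omega, h⟩
  exact le_antisymm
    (E.le_of_frequently_mass_le hplus hminus hK (hsucc.mono fun n hn => (hmass n hn).1))
    (E.le_of_frequently_mass_le hminus hplus hK (hsucc.mono fun n hn => (hmass n hn).2))
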